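/- For an integer $k\ge 1$ let $F_k:\mathbb{N}\to\mathbb{N}$ be defined by $F_k(0)=0$ and $F_k(n)=n-F_k^k(n-1)$ for $n\ge 1$, where $F_k^k$ is the $k$-th iterate of $F_k$. Let $(A_{k,p})_{p\ge 0}$ be given by $A_{k,p}=p+1$ for $0\le p<k$ and $A_{k,p}=A_{k,p-1}+A_{k,p-k}$ for $p\ge k$. Let $\alpha_k$ be the unique positive zero of $X^k+X-1$ and $\beta_k$ the unique positive zero of $Q_k(X)=X^k-X^{k-1}-1$, and let $r_{k,0},\ldots,r_{k,k-1}$ be the $k$ complex zeros of $Q_k$ listed in decreasing lexicographic order of their Cartesian coordinates (real part, imaginary part). Put $\delta_k(n)=F_k(n)-\alpha_k n$ and $\Delta_k=\sup_{n\in\mathbb{N}}|\delta_k(n)|$. Theorem. Let $k\ge 6$. Then $\Delta_k=+\infty$, and even $\sup_n\delta_k(n)=+\infty$ and $\inf_n\delta_k(n)=-\infty$. More precisely, put $a=\ln|r_{k,1}|/\ln\beta_k$. Then $0<a<1$, and there exist a real constant $C>0$ and two subsequences $(u_n)_{n\ge 0}$ and $(u'_n)_{n\ge 0}$ of $(A_{k,p})_{p\ge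 0}$ such that for all $n\ge 0$, \[ \delta_k(u_n)>C\,(u_n)^a\qquad\text{and}\qquad \delta_k(u'_n)<-C\,(u'_n)^a . \] -/

import Mathlib

namespace Hofstadter

/-- Recursive construction of `F_k`, carried out together with the bound `F_k n ≤ n` that makes the
nested recursive calls legitimate: the value at `n + 1` is `n + 1` minus the `k`-th iterate, at `n`,
of the function already built on `{0, …, n}`. -/
def Faux (k : ℕ) : (n : ℕ) → {m : ℕ // m ≤ n}
  | 0 => ⟨0, le_rfl⟩
  | n + 1 =>
    ⟨n + 1 - ((fun x : {m : ℕ // m ≤ n} =>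
        (⟨(Faux k x.1).1, (Faux k x.1).2.trans x.2⟩ : {m : ℕ // m ≤ n}))^[k] ⟨n, le_rfl⟩).1,
      Nat.sub_le _ _⟩
  termination_by n => n
  decreasing_by all_goals exact Nat.lt_succ_of_le x.2

/-- Hofstadter's function `F_k`. -/
def F (k n : ℕ) : ℕ := (Faux k n).1

theorem F_le (k n : ℕ) : F k n ≤ n := (Faux k n).2

theorem F_zero (k : ℕ) : F k 0 = 0 := Nat.le_zero.mp (F_le k 0)

theorem F_iterate_le (k j n : ℕ) : (F k)^[j] n ≤ n := by
  induction j with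
  | zero => exact le_rfl
  | succ j ih =>
    rw [Function.iterate_succ_apply']
    exact (F_le k _).trans ih

/-- The defining equation of `F_k`: `F_k(n+1) = (n+1) - F_k^k(n)` (`k`-th iterate). -/
theorem F_succ (k n : ℕ) : F k (n + 1) = n + 1 - (F k)^[k] n := by
  have key : ∀ (j : ℕ) (x : {m : ℕ // m ≤ n}),
      ((fun x : {m : ℕ // m ≤ n} =>
        (⟨(Faux k x.1).1, (Faux k x.1).2.trans x.2⟩ : {m : ℕ // m ≤ n}))^[j] x).1
        = (F k)^[j] x.1 := by
    intro j
    induction j with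
    | zero => intro x; rfl
    | succ j ih =>
      intro x
      rw [Function.iterate_succ_apply, Function.iterate_succ_apply, ih]
      rfl
  have h := key k ⟨n, le_rfl⟩
  rw [F, Faux]
  exact congrArg (fun t => n + 1 - t) h

/-- The same equation without subtraction (so no truncation is involved). -/
theorem F_succ_add (k n : ℕ) : F k (n + 1) + (F k)^[k] n = n + 1 := by
  have h := F_iterate_le k k n
  rw [F_succ]
  omega

/-- The Fibonacci-like sequence `A_{k,p}` (for `k ≥ 1`): `p + 1` if `p < k`, and
`A_{k,p-1} + A_{k,p-k}` if `p ≥ k`. -/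
def A (k : ℕ) (p : ℕ) : ℕ :=
  if _h : 1 ≤ k ∧ k ≤ p then A k (p - 1) + A k (p - k) else p + 1
  termination_by p
  decreasing_by all_goals omega

theorem A_of_lt {k p : ℕ} (h : p < k) : A k p = p + 1 := by
  rw [A, dif_neg (by omega)]

theorem A_of_le {k p : ℕ} (hk : 1 ≤ k) (h : k ≤ p) : A k p = A k (p - 1) + A k (p - k) := by
  rw [A, dif_pos ⟨hk, h⟩]

/-- `P_k = X^k + X - 1`. -/
noncomputable def P (k : ℕ) : Polynomial ℤ := Polynomial.X ^ k + Polynomial.X - 1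

/-- `Q_k = X^k - X^(k-1) - 1`. -/
noncomputable def Q (k : ℕ) : Polynomial ℤ := Polynomial.X ^ k - Polynomial.X ^ (k - 1) - 1

theorem aeval_P (k : ℕ) (x : ℝ) : Polynomial.aeval x (P k) = x ^ k + x - 1 := by
  simp [P]

theorem aeval_Q (k : ℕ) (x : ℝ) : Polynomial.aeval x (Q k) = x ^ k - x ^ (k - 1) - 1 := by
  simp [Q]

theorem existsUnique_pos_root_P {k : ℕ} (hk : 1 ≤ k) :
    ∃! x : ℝ, 0 < x ∧ Polynomial.aeval x (P k) = 0 := by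
  have hk0 : k ≠ 0 := by omega
  simp only [aeval_P]
  have hc : ContinuousOn (fun x : ℝ => x ^ k + x - 1) (Set.Icc 0 1) := by fun_prop
  have hmem : (0 : ℝ) ∈ Set.Icc ((fun x : ℝ => x ^ k + x - 1) 0)
      ((fun x : ℝ => x ^ k + x - 1) 1) := by
    constructor <;> simp [hk0]
  obtain ⟨x, hx, hx0⟩ := intermediate_value_Icc zero_le_one hc hmem
  have hx0' : x ^ k + x - 1 = 0 := hx0
  have hpos : 0 < x := by
    rcases hx.1.lt_or_eq with h | h
    · exact h
    · rw [← h, zero_pow hk0] at hx0'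
      norm_num at hx0'
  refine ⟨x, ⟨hpos, hx0'⟩, ?_⟩
  rintro y ⟨hy, hy0⟩
  rcases lt_trichotomy y x with h | h | h
  · have := pow_lt_pow_left₀ h hy.le hk0
    linarith
  · exact h
  · have := pow_lt_pow_left₀ h hpos.le hk0
    linarith

theorem root_Q_iff_inv {k : ℕ} (hk : 1 ≤ k) {x : ℝ} (hx : 0 < x) :
    Polynomial.aeval x (Q k) = 0 ↔ Polynomial.aeval x⁻¹ (P k) = 0 := by
  obtain ⟨m, rfl⟩ : ∃ m, k = m + 1 := ⟨k - 1, by omega⟩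
  have hne : x ≠ 0 := hx.ne'
  rw [aeval_P, aeval_Q, Nat.add_sub_cancel]
  have h : x ^ (m + 1) * (x⁻¹ ^ (m + 1) + x⁻¹ - 1) = -(x ^ (m + 1) - x ^ m - 1) := by
    have h1 : x ^ (m + 1) * x⁻¹ ^ (m + 1) = 1 := by
      rw [← mul_pow, mul_inv_cancel₀ hne, one_pow]
    have h2 : x ^ (m + 1) * x⁻¹ = x ^ m := by
      rw [pow_succ, mul_assoc, mul_inv_cancel₀ hne, mul_one]
    linear_combination h1 + h2
  constructor
  · intro h0
    rw [h0, neg_zero] at h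
    exact (mul_eq_zero.mp h).resolve_left (pow_ne_zero _ hne)
  · intro h0
    rw [h0, mul_zero] at h
    linarith

theorem existsUnique_pos_root_Q {k : ℕ} (hk : 1 ≤ k) :
    ∃! x : ℝ, 0 < x ∧ Polynomial.aeval x (Q k) = 0 := by
  obtain ⟨a, ⟨ha, ha0⟩, hu⟩ := existsUnique_pos_root_P hk
  refine ⟨a⁻¹, ⟨inv_pos.mpr ha, ?_⟩, ?_⟩
  · rw [root_Q_iff_inv hk (inv_pos.mpr ha), inv_inv]
    exact ha0
  · rintro y ⟨hy, hy0⟩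
    rw [← hu y⁻¹ ⟨inv_pos.mpr hy, (root_Q_iff_inv hk hy).mp hy0⟩, inv_inv]

open Classical in
/-- `α_k`, the unique positive zero of `P_k` (for `k ≥ 1`; the value at `k = 0` is irrelevant). -/
noncomputable def alpha (k : ℕ) : ℝ :=
  if hk : 1 ≤ k then (existsUnique_pos_root_P hk).choose else 0

open Classical in
/-- `β_k`, the unique positive zero of `Q_k` (for `k ≥ 1`; the value at `k = 0` is irrelevant). -/
noncomputable def beta (k : ℕ) : ℝ :=
  if hk : 1 ≤ k then (existsUnique_pos_root_Q hk).choose else 0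

theorem alpha_spec {k : ℕ} (hk : 1 ≤ k) :
    0 < alpha k ∧ Polynomial.aeval (alpha k) (P k) = 0 := by
  rw [alpha, dif_pos hk]
  exact (existsUnique_pos_root_P hk).choose_spec.1

theorem beta_spec {k : ℕ} (hk : 1 ≤ k) :
    0 < beta k ∧ Polynomial.aeval (beta k) (Q k) = 0 := by
  rw [beta, dif_pos hk]
  exact (existsUnique_pos_root_Q hk).choose_spec.1

/-- `z` comes before (or equals) `w` in the decreasing lexicographic order of the Cartesian
coordinates `(re, im)`. -/
def lexGE (z w : ℂ) : Prop := w.re < z.re ∨ (w.re = z.re ∧ w.im ≤ z.im)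

noncomputable instance : DecidableRel lexGE := Classical.decRel _

instance : IsTrans ℂ lexGE where
  trans a b c hab hbc := by
    unfold lexGE at *
    rcases hab with h | ⟨h, h'⟩ <;> rcases hbc with g | ⟨g, g'⟩
    · exact Or.inl (g.trans h)
    · exact Or.inl (g ▸ h)
    · exact Or.inl (h ▸ g)
    · exact Or.inr ⟨g.trans h, g'.trans h'⟩

instance : Std.Antisymm lexGE where
  antisymm a b hab hba := by
    unfold lexGE at *
    rcases hab with h | ⟨h, h'⟩ <;> rcases hba with g | ⟨g, g'⟩
    · exact absurd h g.asymm
    · exact absurd g h.ne'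
    · exact absurd h g.ne'
    · exact Complex.ext g (le_antisymm g' h')

instance : Std.Total lexGE where
  total a b := by
    unfold lexGE
    rcases lt_trichotomy a.re b.re with h | h | h
    · exact Or.inr (Or.inl h)
    · rcases le_total a.im b.im with g | g
      · exact Or.inr (Or.inr ⟨h, g⟩)
      · exact Or.inl (Or.inr ⟨h.symm, g⟩)
    · exact Or.inl (Or.inl h)

/-- The list of the complex zeros of `Q_k`, in decreasing lexicographic order of their Cartesian
coordinates. -/
noncomputable def rootList (k : ℕ) : List ℂ := ((Q k).aroots ℂ).sort lexGE

/-- The list has `k` entries. -/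
theorem length_rootList {k : ℕ} (hk : 1 ≤ k) : (rootList k).length = k := by
  have hdeg : (Q k).natDegree = k := by
    obtain ⟨m, rfl⟩ : ∃ m, k = m + 1 := ⟨k - 1, by omega⟩
    unfold Q
    rw [Nat.add_sub_cancel]
    compute_degree!
  have hinj : Function.Injective (algebraMap ℤ ℂ) := (algebraMap ℤ ℂ).injective_int
  rw [rootList, Multiset.length_sort, Polynomial.aroots,
    ← (IsAlgClosed.splits ((Q k).map (algebraMap ℤ ℂ))).natDegree_eq_card_roots,
    Polynomial.natDegree_map_eq_of_injective hinj, hdeg]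

/-- `r_{k,i}`, for `0 ≤ i < k` (the value for other `i` is irrelevant). -/
noncomputable def r (k i : ℕ) : ℂ := (rootList k).getD i 0

/-- `δ_k(n) = F_k(n) - α_k n`. -/
noncomputable def delta (k n : ℕ) : ℝ := (F k n : ℝ) - alpha k * (n : ℝ)

/-- The discrepancy `Δ_k = sup_n |δ_k(n)|`, as an extended real number. -/
noncomputable def discrepancy (k : ℕ) : EReal := ⨆ n : ℕ, ((|delta k n| : ℝ) : EReal)

/-- The exponent `a = ln |r_{k,1}| / ln β_k`. -/
noncomputable def exponent (k : ℕ) : ℝ := Real.log ‖r k 1‖ / Real.log (beta k)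

/-- `u` is a subsequence of `v`. -/
def IsSubsequence (u v : ℕ → ℕ) : Prop := ∃ φ : ℕ → ℕ, StrictMono φ ∧ ∀ n, u n = v (φ n)

end Hofstadter

namespace Hofstadter

/-! ### Monotonicity of `F` and its values on the sequence `A` -/

/-! `F` shifts the sequence `A` by one index (`F_A_succ`), so on this sequence the discrepancy is
A_p - α A_{p+1}. As `Q` has simple zeros, A_p is a combination of p-th powers of these zeros
(`A_eq_sum`). In the discrepancy each zero z picks up the factor 1 - αz, which vanishes exactly at z
= β because αβ = 1 (`delta_A_succ`).

Among the zeros, the modulus strictly orders the real parts (`two_mul_re_root`,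
`re_lt_re_of_norm_lt`). So once β is gone, `r k 1` and its conjugate strictly dominate, and the
discrepancy is |r_1|^p (2 Re(d u^p) + o(1)) with d ≠ 0 and u = r_1/|r_1| (`exists_tendsto_delta_A`).
Since u is a non-real point of the unit circle, Re(d u^p) exceeds a fixed positive constant
infinitely often; the same holds for -d (`exists_frequently_lt_re_mul_pow`).

Finally |r_1| > 1 when k ≥ 6 (`exists_root_norm_gt_one`), and A_p = O(β^p) with β^a = |r_1| turns
|r_1|^p into the power A_p^a. -/

/-- Iterating a map with increments 0 or 1 again gives increments 0 or 1, and n + 1 minus such a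
quantity keeps this property. Iterates never exceed their argument, so strong induction applies. -/
theorem F_succ_bounds (k n : ℕ) : F k n ≤ F k (n + 1) ∧ F k (n + 1) ≤ F k n + 1 := by
  induction n using Nat.strong_induction_on with
  | _ n ih =>
    rcases n with _ | n
    · have := F_le k (0 + 1)
      simp only [F_zero]
      omega
    · have key : ∀ j, (F k)^[j] n ≤ (F k)^[j] (n + 1) ∧
          (F k)^[j] (n + 1) ≤ (F k)^[j] n + 1 := by
        intro j
        induction j with
        | zero => simp
        | succ j ihj =>
          rw [Function.iterate_succ_apply', Function.iterate_succ_apply']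
          have hle := F_iterate_le k j n
          rcases (by omega : (F k)^[j] (n + 1) = (F k)^[j] n ∨
            (F k)^[j] (n + 1) = (F k)^[j] n + 1) with h | h
          · rw [h]; omega
          · rw [h]; exact ih _ (by omega)
      have h1 := F_succ_add k n
      have h2 := F_succ_add k (n + 1)
      have h3 := key k
      omega

theorem F_monotone (k : ℕ) : Monotone (F k) :=
  monotone_nat_of_le_succ fun n => (F_succ_bounds k n).1

theorem F_one (k : ℕ) : F k 1 = 1 := by
  have h := F_succ_add k 0
  rw [Function.iterate_fixed (F_zero k) k] at h
  exact h

/-- The sequence `A` extended to the left by `k - 1` further ones. -/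
def extA (k n : ℕ) : ℕ := if n + 1 < k then 1 else A k (n + 1 - k)

theorem extA_of_lt {k n : ℕ} (h : n < k) : extA k n = 1 := by
  unfold extA
  split_ifs with h'
  · rfl
  · rw [A_of_lt (by omega)]
    omega

theorem extA_add {k : ℕ} (hk : 1 ≤ k) (n : ℕ) : extA k (n + k) = extA k (n + k - 1) + extA k n := by
  unfold extA
  rw [if_neg (by omega), if_neg (by omega), (by omega : n + k + 1 - k = n + 1),
    (by omega : n + k - 1 + 1 - k = n)]
  split_ifs with h
  · rw [A_of_lt (by omega), A_of_lt (by omega)]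
  · rcases (by omega : n + 1 < k ∨ k ≤ n + 1) with h' | h'
    · omega
    · rw [A_of_le hk h', Nat.add_sub_cancel]

theorem extA_pred {k n : ℕ} (hk : 1 ≤ k) (h : k ≤ n) :
    extA k n = extA k (n - 1) + extA k (n - k) := by
  obtain ⟨m, rfl⟩ := Nat.exists_eq_add_of_le' h
  rw [extA_add hk, Nat.add_sub_cancel]

/-- The summand m makes the induction close: the case m = 0 at n is the case m = `extA k (n - k)` at
n - 1, the largest m allowed there. To pass from m to m + 1, the shift is applied k times, giving
F^k(extA n + m) = extA (n - k) + F^k(m), and the recurrences for `F` and `extA` are compared. -/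
theorem F_extA_add {k : ℕ} (hk : 2 ≤ k) (n : ℕ) (hn : k ≤ n) :
    ∀ m ≤ extA k (n + 1 - k), F k (extA k n + m) = extA k (n - 1) + F k m := by
  have hk1 : 1 ≤ k := by omega
  induction n using Nat.strong_induction_on with
  | _ n ih =>
    have hF : ∀ q < n, F k (extA k q) = extA k (q - 1) := by
      intro q hq
      rcases lt_or_ge q k with h | h
      · rw [extA_of_lt h, extA_of_lt (by omega), F_one k]
      · simpa [F_zero] using ih q hq h 0 (Nat.zero_le _)
    have h0 : F k (extA k n) = extA k (n - 1) := by
      rcases hn.eq_or_lt with h | h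
      · rw [← h, extA_pred hk1 le_rfl, extA_of_lt (by omega), extA_of_lt (by omega)]
        have h2 := F_succ_add k 1
        rw [Function.iterate_fixed (F_one k) k] at h2
        omega
      · rw [extA_pred hk1 hn, ih (n - 1) (by omega) (by omega) _ (by
          rw [(by omega : n - 1 + 1 - k = n - k)]), hF _ (by omega),
          extA_pred hk1 (by omega : k ≤ n - 1), (by omega : n - k - 1 = n - 1 - k)]
    intro m
    induction m with
    | zero => intro _; simpa [F_zero] using h0
    | succ m ihm =>
      intro hm
      have key : ∀ j ≤ k, (F k)^[j] (extA k n + m) = extA k (n - j) + (F k)^[j] m ∧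
          (F k)^[j] m ≤ extA k (n + 1 - k - j) := by
        intro j
        induction j with
        | zero => intro _; exact ⟨rfl, by simp; omega⟩
        | succ j ihj =>
          intro hj
          obtain ⟨e, b⟩ := ihj (by omega)
          simp only [Function.iterate_succ_apply']
          refine ⟨?_, ?_⟩
          · rw [e]
            rcases j with _ | j
            · simpa using ihm (by omega)
            · rcases Nat.eq_zero_or_pos m with rfl | hm0
              · rw [Function.iterate_fixed (F_zero k), F_zero, add_zero, hF _ (by omega)]
                rfl
              -- With m ≥ 1, the bound m + 1 ≤ `extA k (n + 1 - k)` puts that index beyond the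
              -- initial ones, so every index n - (j + 1) met here is still at least k.
              · have hge : k ≤ n + 1 - k := by
                  by_contra h
                  rw [extA_of_lt (by omega)] at hm
                  omega
                exact ih _ (by omega) (by omega) _ (by
                  rwa [(by omega : n - (j + 1) + 1 - k = n + 1 - k - (j + 1))])
          · refine (F_monotone k b).trans ?_
            rw [hF _ (by omega)]
            exact le_rfl
      have h1 := F_succ_add k (extA k n + m)
      have h2 := F_succ_add k m
      rw [(key k le_rfl).1] at h1
      have h3 := extA_pred hk1 hn
      rw [← add_assoc]
      omega

theorem F_A_succ {k : ℕ} (hk : 2 ≤ k) (p : ℕ) : F k (A k (p + 1)) = A k p := by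
  have h := F_extA_add hk (p + k) (by omega) 0 (Nat.zero_le _)
  simp only [add_zero, F_zero, extA] at h
  rwa [if_neg (by omega), if_neg (by omega), (by omega : p + k + 1 - k = p + 1),
    (by omega : p + k - 1 + 1 - k = p)] at h

theorem A_pos {k : ℕ} (p : ℕ) : 0 < A k p := by
  induction p using Nat.strong_induction_on with
  | _ p ih =>
    rw [A]
    split_ifs with h
    · have := ih (p - 1) (by omega)
      omega
    · omega

theorem A_strictMono {k : ℕ} (hk : 1 ≤ k) : StrictMono (A k) := by
  refine strictMono_nat_of_lt_succ fun p => ?_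
  rcases lt_or_ge (p + 1) k with h | h
  · rw [A_of_lt h, A_of_lt (by omega)]
    omega
  · rw [A_of_le hk h, Nat.add_sub_cancel]
    have := A_pos (k := k) (p + 1 - k)
    omega

/-! ### The real zeros -/

theorem beta_pow {k : ℕ} (hk : 1 ≤ k) : beta k ^ k = beta k ^ (k - 1) + 1 := by
  have h := (beta_spec hk).2
  rw [aeval_Q] at h
  linarith

theorem alpha_mul_beta {k : ℕ} (hk : 1 ≤ k) : alpha k * beta k = 1 := by
  obtain ⟨hb, hb0⟩ := beta_spec hk
  have h := (existsUnique_pos_root_P hk).unique (alpha_spec hk)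
    ⟨inv_pos.mpr hb, (root_Q_iff_inv hk hb).mp hb0⟩
  rw [h, inv_mul_cancel₀ hb.ne']

theorem one_lt_beta {k : ℕ} (hk : 1 ≤ k) : 1 < beta k := by
  have hb := (beta_spec hk).1
  by_contra! h
  have h1 := beta_pow hk
  have h2 : beta k ^ k ≤ beta k ^ (k - 1) := pow_le_pow_of_le_one hb.le h (by omega)
  linarith

theorem A_le_mul_beta_pow {k : ℕ} (hk : 1 ≤ k) (p : ℕ) : (A k p : ℝ) ≤ k * beta k ^ p := by
  induction p using Nat.strong_induction_on with
  | _ p ih =>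
    rcases lt_or_ge p k with h | h
    · rw [A_of_lt h]
      have h1 : (1 : ℝ) ≤ beta k ^ p := one_le_pow₀ (one_lt_beta hk).le
      have h2 : ((p + 1 : ℕ) : ℝ) ≤ k := by exact_mod_cast h
      nlinarith
    · rw [A_of_le hk h]
      have h1 := ih (p - 1) (by omega)
      have h2 := ih (p - k) (by omega)
      have e1 : beta k ^ p = beta k ^ (p - k) * beta k ^ k := by
        rw [← pow_add]; congr 1; omega
      have e2 : beta k ^ (p - 1) = beta k ^ (p - k) * beta k ^ (k - 1) := by
        rw [← pow_add]; congr 1; omega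
      rw [e2] at h1
      rw [e1, beta_pow hk]
      push_cast
      linarith

open Polynomial

/-! ### The complex zeros of `Q` -/

theorem mem_aroots_Q {k : ℕ} {z : ℂ} :
    z ∈ (Q k).aroots ℂ ↔ z ^ k = z ^ (k - 1) + 1 := by
  have hne : Q k ≠ 0 := by
    intro h
    have h1 := congrArg (Polynomial.eval 1) h
    simp [Q] at h1
  rw [mem_aroots', and_iff_right ((Polynomial.map_ne_zero_iff (algebraMap ℤ ℂ).injective_int).mpr hne)]
  simp only [Q, map_sub, map_pow, aeval_X, map_one]
  rw [sub_sub, sub_eq_zero]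

theorem norm_pow_mul_norm_sub_one {k : ℕ} (hk : 1 ≤ k) {z : ℂ} (hz : z ^ k = z ^ (k - 1) + 1) :
    ‖z‖ ^ (k - 1) * ‖z - 1‖ = 1 := by
  obtain ⟨m, rfl⟩ : ∃ m, k = m + 1 := ⟨k - 1, by omega⟩
  rw [Nat.add_sub_cancel] at *
  rw [← norm_pow, ← norm_mul, show z ^ m * (z - 1) = 1 by linear_combination hz, norm_one]

theorem zero_ne_of_root {k : ℕ} (hk : 2 ≤ k) {z : ℂ} (hz : z ^ k = z ^ (k - 1) + 1) : z ≠ 0 := by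
  rintro rfl
  rw [zero_pow (by omega), zero_pow (by omega)] at hz
  norm_num at hz

/-- Twice the real part of a zero is an increasing function of its modulus. -/
theorem two_mul_re_root {k : ℕ} (hk : 2 ≤ k) {z : ℂ} (hz : z ^ k = z ^ (k - 1) + 1) :
    2 * z.re = ‖z‖ ^ 2 + 1 - ((‖z‖ ^ (k - 1)) ^ 2)⁻¹ := by
  have h0 : 0 < ‖z‖ := norm_pos_iff.mpr (zero_ne_of_root hk hz)
  have h1 := norm_pow_mul_norm_sub_one (by omega) hz
  have h2 : ‖z - 1‖ = (‖z‖ ^ (k - 1))⁻¹ := eq_inv_of_mul_eq_one_right h1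
  rw [← inv_pow, ← h2, Complex.sq_norm, Complex.sq_norm, Complex.normSq_apply, Complex.normSq_apply]
  simp
  ring

theorem re_lt_re_of_norm_lt {k : ℕ} (hk : 2 ≤ k) {z w : ℂ} (hz : z ^ k = z ^ (k - 1) + 1)
    (hw : w ^ k = w ^ (k - 1) + 1) (h : ‖z‖ < ‖w‖) : z.re < w.re := by
  have hz0 : 0 < ‖z‖ := norm_pos_iff.mpr (zero_ne_of_root hk hz)
  have h1 := two_mul_re_root hk hz
  have h2 := two_mul_re_root hk hw
  have h3 : ‖z‖ ^ 2 < ‖w‖ ^ 2 := by gcongr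
  have h4 : ((‖w‖ ^ (k - 1)) ^ 2)⁻¹ ≤ ((‖z‖ ^ (k - 1)) ^ 2)⁻¹ := by gcongr
  linarith

theorem norm_le_of_re_le {k : ℕ} (hk : 2 ≤ k) {z w : ℂ} (hz : z ^ k = z ^ (k - 1) + 1)
    (hw : w ^ k = w ^ (k - 1) + 1) (h : z.re ≤ w.re) : ‖z‖ ≤ ‖w‖ := by
  by_contra! h'
  exact absurd (re_lt_re_of_norm_lt hk hw hz h') (by linarith)

/-- The modulus of a zero determines its real part, hence its imaginary part up to sign. -/
theorem eq_or_eq_conj_of_norm_eq {k : ℕ} (hk : 2 ≤ k) {z w : ℂ} (hz : z ^ k = z ^ (k - 1) + 1)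
    (hw : w ^ k = w ^ (k - 1) + 1) (h : ‖z‖ = ‖w‖) : z = w ∨ z = (starRingEnd ℂ) w := by
  have h1 := two_mul_re_root hk hz
  have h2 := two_mul_re_root hk hw
  rw [h] at h1
  have hre : z.re = w.re := by linarith
  have h3 : ‖z‖ ^ 2 = ‖w‖ ^ 2 := by rw [h]
  rw [Complex.sq_norm, Complex.sq_norm, Complex.normSq_apply, Complex.normSq_apply, hre] at h3
  rcases mul_self_eq_mul_self_iff.mp (by linarith : z.im * z.im = w.im * w.im) with h4 | h4
  · exact Or.inl (Complex.ext hre h4)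
  · exact Or.inr (Complex.ext (by simpa using hre) (by simpa using h4))

theorem conj_root {k : ℕ} {z : ℂ} (hz : z ^ k = z ^ (k - 1) + 1) :
    (starRingEnd ℂ) z ^ k = (starRingEnd ℂ) z ^ (k - 1) + 1 := by
  have h := congrArg (starRingEnd ℂ) hz
  simpa using h

theorem beta_root {k : ℕ} (hk : 1 ≤ k) : (beta k : ℂ) ^ k = (beta k : ℂ) ^ (k - 1) + 1 := by
  exact_mod_cast beta_pow hk

/-- The triangle inequality gives |z|^(k-1) (|z| - 1) ≤ 1, with equality at β, and the left side
increases for |z| ≥ 1. -/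
theorem norm_root_le_beta {k : ℕ} (hk : 1 ≤ k) {z : ℂ} (hz : z ^ k = z ^ (k - 1) + 1) :
    ‖z‖ ≤ beta k := by
  by_contra! h
  have hb := one_lt_beta hk
  have h1 : ‖z‖ ^ (k - 1) * ‖z‖ ≤ ‖z‖ ^ (k - 1) + 1 := by
    rw [← pow_succ, Nat.sub_add_cancel hk, ← norm_pow, hz, ← norm_pow]
    exact (norm_add_le _ _).trans (by simp)
  have h2 : beta k ^ (k - 1) * beta k = beta k ^ (k - 1) + 1 := by
    rw [← pow_succ, Nat.sub_add_cancel hk, beta_pow hk]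
  have h3 : beta k ^ (k - 1) ≤ ‖z‖ ^ (k - 1) := by gcongr
  nlinarith [pow_pos (by linarith : 0 < beta k) (k - 1)]

theorem norm_root_lt_beta {k : ℕ} (hk : 2 ≤ k) {z : ℂ} (hz : z ^ k = z ^ (k - 1) + 1)
    (hne : z ≠ beta k) : ‖z‖ < beta k := by
  refine (norm_root_le_beta (by omega) hz).lt_of_ne fun h => hne ?_
  have hb := one_lt_beta (k := k) (by omega)
  have h' : ‖z‖ = ‖(beta k : ℂ)‖ := by
    rw [h, Complex.norm_real, Real.norm_of_nonneg (by linarith)]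
  rcases eq_or_eq_conj_of_norm_eq hk hz (beta_root (by omega)) h' with e | e
  · exact e
  · rwa [Complex.conj_ofReal] at e

theorem root_eq_beta_of_im_eq_zero {k : ℕ} (hk : 1 ≤ k) {z : ℂ} (hz : z ^ k = z ^ (k - 1) + 1)
    (him : z.im = 0) (hre : 0 < z.re) : z = beta k := by
  have e : z = (z.re : ℂ) := Complex.ext (by simp) (by simpa using him)
  rw [e] at hz ⊢
  have h1 : z.re ^ k = z.re ^ (k - 1) + 1 := by exact_mod_cast hz
  rw [(existsUnique_pos_root_Q hk).unique (beta_spec hk) ⟨hre, by rw [aeval_Q]; linarith⟩]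

/-- A zero of `Q` in the open upper half plane and outside the closed unit disc. -/
theorem exists_root_norm_gt_one {k : ℕ} (hk : 6 ≤ k) :
    ∃ z : ℂ, z ^ k = z ^ (k - 1) + 1 ∧ 0 < z.im ∧ 1 < ‖z‖ := by
  obtain ⟨m, rfl⟩ : ∃ m, k = m + 1 := ⟨k - 1, by omega⟩
  have hm : (5 : ℝ) ≤ m := by exact_mod_cast (by omega : 5 ≤ m)
  have hpi := Real.pi_pos
  -- Consider the triangle 0, 1, z with t = arg z and φ = arg(z - 1). The equation z^m (z - 1) = 1
  -- is met by φ = 2π - mt together with a condition on moduli; the law of sines gives |z| = sin φ /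
  -- sin(φ - t) and |z - 1| = sin t / sin(φ - t), so that condition is f(t) = 0. At t = a one has φ
  -- - t = π - φ, that is |z| = 1; at t = b the triangle degenerates, φ = t.
  set a : ℝ := 3 * Real.pi / (2 * m + 1) with ha
  set b : ℝ := 2 * Real.pi / (m + 1) with hb
  have hae : a * (2 * m + 1) = 3 * Real.pi := by rw [ha]; field_simp
  have hbe : b * (m + 1) = 2 * Real.pi := by rw [hb]; field_simp
  have hab : a ≤ b := by
    rw [ha, hb, div_le_div_iff₀ (by linarith) (by linarith)]
    nlinarith
  have ha0 : 0 < a := by positivity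
  let φ : ℝ → ℝ := fun t => 2 * Real.pi - m * t
  let f : ℝ → ℝ := fun t => Real.sin (φ t) ^ m * Real.sin t - Real.sin (φ t - t) ^ (m + 1)
  have hf : ContinuousOn f (Set.Icc a b) := by
    simp only [f, φ]
    fun_prop
  -- This is where k ≥ 6 is needed: a < π/3 means 2m + 1 > 9, and f(a) has the sign of 2 sin(a/2) -
  -- 1.
  have ha3 : a < Real.pi / 3 := by
    rw [ha, div_lt_div_iff₀ (by linarith) (by norm_num)]
    nlinarith
  have hfa : f a < 0 := by
    have e : φ a = Real.pi / 2 + a / 2 := by simp only [φ]; linarith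
    have e2 : φ a - a = Real.pi / 2 - a / 2 := by rw [e]; ring
    have e3 : Real.sin a = 2 * Real.sin (a / 2) * Real.cos (a / 2) := by
      rw [← Real.sin_two_mul]; congr 1; ring
    simp only [f]
    rw [e2, e, Real.sin_pi_div_two_sub, add_comm, Real.sin_add_pi_div_two, e3, pow_succ,
      show ∀ c s : ℝ, c ^ m * (2 * s * c) - c ^ m * c = c ^ m * c * (2 * s - 1) by
        intros; ring]
    have hc : 0 < Real.cos (a / 2) := Real.cos_pos_of_mem_Ioo ⟨by linarith, by linarith⟩
    have hs : Real.sin (a / 2) < 1 / 2 := by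
      rw [← Real.sin_pi_div_six]
      exact Real.sin_lt_sin_of_lt_of_le_pi_div_two (by linarith) (by linarith) (by linarith)
    exact mul_neg_of_pos_of_neg (by positivity) (by linarith)
  have hbpi : b < Real.pi := by
    rw [hb, div_lt_iff₀ (by linarith)]
    nlinarith
  have hfb : 0 < f b := by
    have e : φ b = b := by simp only [φ]; linarith
    simp only [f]
    rw [e, sub_self, Real.sin_zero, zero_pow (by omega), sub_zero]
    have := Real.sin_pos_of_pos_of_lt_pi (by linarith : 0 < b) hbpi
    positivity
  obtain ⟨t, ⟨hta, htb⟩, ht⟩ := intermediate_value_Icc hab hf ⟨hfa.le, hfb.le⟩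
  have hta' : a < t := hta.lt_of_ne (by rintro rfl; exact hfa.ne ht)
  have htb' : t < b := htb.lt_of_ne (by rintro rfl; exact hfb.ne' ht)
  -- The strict inequalities a < t < b place φ - t strictly between 0 and π - φ, whence sin(φ - t) <
  -- sin φ and |z| > 1.
  have h1 : φ t - t < Real.pi - φ t := by simp only [φ]; nlinarith
  have h2 : 0 < φ t - t := by simp only [φ]; nlinarith
  have hs1 : 0 < Real.sin (φ t - t) := Real.sin_pos_of_pos_of_lt_pi h2 (by linarith)
  have hs2 : 0 < Real.sin t := Real.sin_pos_of_pos_of_lt_pi (by linarith) (by linarith)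
  have hs3 : Real.sin (φ t - t) < Real.sin (φ t) := by
    rcases le_total (φ t) (Real.pi / 2) with h | h
    · exact Real.sin_lt_sin_of_lt_of_le_pi_div_two (by linarith) h (by linarith)
    · rw [← Real.sin_pi_sub (φ t)]
      exact Real.sin_lt_sin_of_lt_of_le_pi_div_two (by linarith) (by linarith) h1
  have ht0 : Real.sin (φ t) ^ m * Real.sin t = Real.sin (φ t - t) ^ (m + 1) := by
    have : f t = 0 := ht
    simp only [f] at this
    linarith
  set S := Real.sin (φ t - t) with hS
  have hSc : (S : ℂ) ≠ 0 := by exact_mod_cast hs1.ne'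
  set z : ℂ := ((Real.sin (φ t) / S : ℝ) : ℂ) * Complex.exp (t * Complex.I) with hz
  have hz1 : z - 1 = ((Real.sin t / S : ℝ) : ℂ) * Complex.exp (φ t * Complex.I) := by
    have hSe : S = Real.sin (φ t) * Real.cos t - Real.cos (φ t) * Real.sin t := Real.sin_sub _ _
    have hSe' := congrArg Complex.ofReal hSe
    rw [hz, Complex.exp_mul_I, Complex.exp_mul_I]
    push_cast at hSe' ⊢
    field_simp
    linear_combination -hSe'
  refine ⟨z, ?_, ?_, ?_⟩
  · have hprod : z ^ m * (z - 1) = 1 := by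
      rw [hz1, hz, mul_pow, ← Complex.exp_nat_mul]
      have e1 : Complex.exp (m * (t * Complex.I)) * Complex.exp (φ t * Complex.I) = 1 := by
        rw [← Complex.exp_add, Complex.exp_eq_one_iff]
        refine ⟨1, ?_⟩
        simp only [φ]
        push_cast
        ring
      have e2 : (((Real.sin (φ t) / S : ℝ) : ℂ)) ^ m * ((Real.sin t / S : ℝ) : ℂ) = 1 := by
        norm_cast
        rw [div_pow, div_mul_div_comm, ht0, ← pow_succ, div_self (by positivity)]
      linear_combination (e2 * Complex.exp (m * (t * Complex.I)) * Complex.exp (φ t * Complex.I)) + e1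
    rw [Nat.add_sub_cancel, pow_succ]
    linear_combination hprod
  · rw [hz, Complex.im_ofReal_mul, Complex.exp_ofReal_mul_I_im]
    exact mul_pos (div_pos (by linarith) hs1) hs2
  · rw [hz, norm_mul, Complex.norm_exp_ofReal_mul_I, mul_one, Complex.norm_real,
      Real.norm_of_nonneg (div_pos (by linarith) hs1).le, one_lt_div hs1]
    exact hs3


/-! ### Simplicity and ordering of the zeros -/

/-- The only nonzero critical point of `Q` is (k - 1)/k, a positive real below 1, whereas the only
positive zero is β > 1. -/
theorem derivative_ne_zero_of_root {k : ℕ} (hk : 2 ≤ k) {z : ℂ} (hz : z ^ k = z ^ (k - 1) + 1) :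
    (k : ℂ) * z ^ (k - 1) - ((k - 1 : ℕ) : ℂ) * z ^ (k - 2) ≠ 0 := by
  intro h
  obtain ⟨m, rfl⟩ : ∃ m, k = m + 2 := ⟨k - 2, by omega⟩
  have h0 := zero_ne_of_root hk hz
  simp only [Nat.add_sub_cancel, (by omega : m + 2 - 1 = m + 1)] at h
  have h1 : z ^ m * (((m + 2 : ℕ) : ℂ) * z - ((m + 1 : ℕ) : ℂ)) = 0 := by
    linear_combination h
  have h2 := (mul_eq_zero.mp h1).resolve_left (pow_ne_zero _ h0)
  have h3 : z = (((m + 1 : ℝ) / (m + 2) : ℝ) : ℂ) := by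
    have : ((m : ℂ) + 2) ≠ 0 := by exact_mod_cast (by omega : m + 2 ≠ 0)
    push_cast at h2 ⊢
    field_simp
    linear_combination h2
  have h4 : 0 < (m + 1 : ℝ) / (m + 2) := by positivity
  have h5 : (m + 1 : ℝ) / (m + 2) < 1 := by
    rw [div_lt_one (by positivity)]
    linarith
  have h6 := root_eq_beta_of_im_eq_zero (by omega) hz (by rw [h3, Complex.ofReal_im])
    (by rwa [h3, Complex.ofReal_re])
  rw [h6] at h3
  have h7 := one_lt_beta (k := m + 2) (by omega)
  rw [Complex.ofReal_injective h3] at h7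
  linarith

theorem monic_map_Q {k : ℕ} (hk : 1 ≤ k) : ((Q k).map (algebraMap ℤ ℂ)).Monic := by
  refine Monic.map _ ?_
  obtain ⟨m, rfl⟩ : ∃ m, k = m + 1 := ⟨k - 1, by omega⟩
  unfold Q
  rw [Nat.add_sub_cancel]
  monicity!

theorem eval_derivative_map_Q (k : ℕ) (z : ℂ) :
    ((Q k).map (algebraMap ℤ ℂ)).derivative.eval z =
      (k : ℂ) * z ^ (k - 1) - ((k - 1 : ℕ) : ℂ) * z ^ (k - 2) := by
  simp [Q, derivative_X_pow, Nat.sub_sub]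

theorem nodup_aroots_Q {k : ℕ} (hk : 2 ≤ k) : ((Q k).aroots ℂ).Nodup := by
  rw [Multiset.nodup_iff_count_le_one]
  intro z
  by_contra! h
  rw [aroots, count_roots,
    one_lt_rootMultiplicity_iff_isRoot (monic_map_Q (by omega)).ne_zero] at h
  have hz : z ^ k = z ^ (k - 1) + 1 := by
    rw [← mem_aroots_Q, aroots, mem_roots (monic_map_Q (by omega)).ne_zero]
    exact h.1
  have h1 := h.2
  rw [IsRoot.def, eval_derivative_map_Q] at h1
  exact derivative_ne_zero_of_root hk hz h1

/-- `r k 1` is a zero of `Q` other than `beta k`, and every zero other than `beta k` has a real part at most that of `r k 1`. -/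
theorem r_one_spec {k : ℕ} (hk : 6 ≤ k) :
    r k 1 ^ k = r k 1 ^ (k - 1) + 1 ∧ r k 1 ≠ beta k ∧
      ∀ z : ℂ, z ^ k = z ^ (k - 1) + 1 → z ≠ beta k → z.re ≤ (r k 1).re := by
  have hlen := length_rootList (k := k) (by omega)
  have hsort : (rootList k).Pairwise lexGE := Multiset.pairwise_sort _ _
  have hnodup : (rootList k).Nodup := by
    rw [← Multiset.coe_nodup, rootList, Multiset.sort_eq]
    exact nodup_aroots_Q (by omega)
  have hmem : ∀ z, z ∈ rootList k ↔ z ^ k = z ^ (k - 1) + 1 := by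
    intro z
    rw [rootList, Multiset.mem_sort, mem_aroots_Q]
  have hr : r k 1 = (rootList k).getD 1 0 := rfl
  generalize rootList k = L at *
  match L, hlen with
  | [], h => simp at h; omega
  | [_], h => simp at h; omega
  | x :: y :: l, _ =>
    have hr' : r k 1 = y := by rw [hr]; rfl
    rw [hr']
    have hx : x ^ k = x ^ (k - 1) + 1 := (hmem x).mp (by simp)
    have hre : ∀ {a b : ℂ}, lexGE a b → b.re ≤ a.re := by
      rintro a b (h | h)
      · exact h.le
      · exact h.1.le
    rw [List.pairwise_cons, List.pairwise_cons] at hsort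
    rw [List.nodup_cons] at hnodup
    -- Otherwise β comes later in the list, so its real part, hence its modulus, is at most that of
    -- x, against the strict maximality of β.
    have hxb : x = beta k := by
      by_contra hne
      have h1 := (List.mem_cons.mp ((hmem (beta k)).mpr (beta_root (by omega)))).resolve_left
        (Ne.symm hne)
      have h2 := norm_le_of_re_le (by omega) (beta_root (by omega)) hx (hre (hsort.1 _ h1))
      have h3 := norm_root_lt_beta (by omega) hx hne
      rw [Complex.norm_real, Real.norm_of_nonneg (beta_spec (by omega)).1.le] at h2
      linarith
    refine ⟨(hmem y).mp (by simp), ?_, ?_⟩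
    · rintro h
      apply hnodup.1
      rw [hxb, ← h]
      simp
    · intro z hz hne
      have h1 := (hmem z).mpr hz
      rw [List.mem_cons, List.mem_cons, hxb] at h1
      rcases h1 with h | h | h
      · exact absurd h hne
      · rw [h]
      · exact hre (hsort.2.1 z h)

theorem one_lt_norm_r_one {k : ℕ} (hk : 6 ≤ k) : 1 < ‖r k 1‖ := by
  obtain ⟨h1, h2, h3⟩ := r_one_spec hk
  obtain ⟨z, hz, him, hn⟩ := exists_root_norm_gt_one hk
  refine hn.trans_le (norm_le_of_re_le (by omega) hz h1 (h3 z hz ?_))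
  rintro rfl
  simp at him

/-- A zero of modulus above 1 has positive real part by `two_mul_re_root`, so if real it would be β.
-/
theorem im_r_one_ne_zero {k : ℕ} (hk : 6 ≤ k) : (r k 1).im ≠ 0 := by
  obtain ⟨h1, h2, h3⟩ := r_one_spec hk
  intro him
  refine h2 (root_eq_beta_of_im_eq_zero (by omega) h1 him ?_)
  have h4 := two_mul_re_root (by omega) h1
  have h5 := one_lt_norm_r_one hk
  have h6 : (1 : ℝ) ≤ (‖r k 1‖ ^ (k - 1)) ^ 2 := one_le_pow₀ (one_le_pow₀ h5.le)
  have h7 := inv_le_one_of_one_le₀ h6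
  nlinarith

theorem norm_lt_norm_r_one {k : ℕ} (hk : 6 ≤ k) {z : ℂ} (hz : z ^ k = z ^ (k - 1) + 1)
    (hb : z ≠ beta k) (h1 : z ≠ r k 1) (h2 : z ≠ (starRingEnd ℂ) (r k 1)) : ‖z‖ < ‖r k 1‖ := by
  obtain ⟨g1, g2, g3⟩ := r_one_spec hk
  refine (norm_le_of_re_le (by omega) hz g1 (g3 z hz hb)).lt_of_ne fun h => ?_
  rcases eq_or_eq_conj_of_norm_eq (by omega) hz g1 h with e | e
  · exact h1 e
  · exact h2 e

/-! ### The closed form of `A` -/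

/-- The Lagrange weight `1 / Q'(z)`. -/
noncomputable def weight (k : ℕ) (z : ℂ) : ℂ :=
  ((k : ℂ) * z ^ (k - 1) - ((k - 1 : ℕ) : ℂ) * z ^ (k - 2))⁻¹

theorem weight_conj (k : ℕ) (z : ℂ) :
    weight k ((starRingEnd ℂ) z) = (starRingEnd ℂ) (weight k z) := by
  simp [weight]

/-- Lagrange interpolation of X^n at the k zeros is exact for n < k; the sum is its coefficient of
degree k - 1. The weights are 1/Q'(z) because `Q` is the nodal polynomial of its zeros. -/
theorem sum_pow_mul_weight {k : ℕ} (hk : 2 ≤ k) {n : ℕ} (hn : n < k) :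
    ∑ z ∈ ((Q k).aroots ℂ).toFinset, z ^ n * weight k z = if n = k - 1 then 1 else 0 := by
  set s := ((Q k).aroots ℂ).toFinset with hs
  have hsval : s.val = (Q k).aroots ℂ := by
    rw [hs, Multiset.toFinset_val, (nodup_aroots_Q hk).dedup]
  have hcard : s.card = k := by
    rw [Finset.card_def, hsval, ← Multiset.length_sort (r := lexGE)]
    exact length_rootList (by omega)
  have hnodal : Lagrange.nodal s (id : ℂ → ℂ) = (Q k).map (algebraMap ℤ ℂ) := by
    have h := (IsAlgClosed.splits ((Q k).map (algebraMap ℤ ℂ))).eq_prod_roots_of_monic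
      (monic_map_Q (by omega))
    rw [h, Lagrange.nodal_eq, Finset.prod, hsval]
    rfl
  have hw : ∀ z ∈ s, weight k z = (∏ j ∈ s.erase z, (id z - id j))⁻¹ := by
    intro z hz
    have h := Lagrange.nodalWeight_eq_eval_derivative_nodal (v := id) hz
    rw [Lagrange.nodalWeight, hnodal, id, eval_derivative_map_Q, Finset.prod_inv_distrib] at h
    rw [weight, ← h]
    rfl
  have h := Lagrange.coeff_eq_sum (s := s) (v := id) (P := (X : ℂ[X]) ^ n) Function.injective_id.injOn
    (by rw [degree_X_pow, hcard]; exact_mod_cast hn)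
  rw [coeff_X_pow, hcard] at h
  rw [Finset.sum_congr rfl fun z hz => by rw [hw z hz]]
  simp only [eval_pow, eval_X, id, div_eq_mul_inv] at h ⊢
  rw [← h]
  simp only [eq_comm]

/-- The power sums S satisfy the recurrence of `A`, with S = 0 at the first k - 1 indices. Hence S =
1 at the next k indices, the last of which is 2k - 2; from there S grows by 1 per step, as `A` does
from A_0 = 1. -/
theorem A_eq_sum {k : ℕ} (hk : 2 ≤ k) (p : ℕ) :
    (A k p : ℂ) = ∑ z ∈ ((Q k).aroots ℂ).toFinset, z ^ (p + (2 * k - 2)) * weight k z := by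
  set S : ℕ → ℂ := fun n => ∑ z ∈ ((Q k).aroots ℂ).toFinset, z ^ n * weight k z with hS
  have hrec : ∀ n, S (n + k) = S (n + k - 1) + S n := by
    intro n
    simp only [hS]
    rw [← Finset.sum_add_distrib]
    refine Finset.sum_congr rfl fun z hz => ?_
    rw [Multiset.mem_toFinset, mem_aroots_Q] at hz
    rw [(by omega : n + k - 1 = n + (k - 1)), pow_add, pow_add, hz]
    ring
  have h0 : ∀ n < k - 1, S n = 0 := fun n hn => by
    simp only [hS]
    rw [sum_pow_mul_weight hk (by omega), if_neg (by omega)]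
  have h1 : ∀ j < k, S (k - 1 + j) = 1 := by
    intro j
    induction j with
    | zero =>
      intro _
      simp only [hS]
      rw [add_zero, sum_pow_mul_weight hk (by omega), if_pos rfl]
    | succ j ih =>
      intro hj
      rw [(by omega : k - 1 + (j + 1) = j + k), hrec, (by omega : j + k - 1 = k - 1 + j),
        ih (by omega), h0 j (by omega), add_zero]
  change (A k p : ℂ) = S (p + (2 * k - 2))
  induction p using Nat.strong_induction_on with
  | _ p ih =>
    rcases p with _ | p
    · rw [A_of_lt (by omega), (by omega : 0 + (2 * k - 2) = k - 1 + (k - 1)), h1 _ (by omega)]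
      simp
    · rw [(by omega : p + 1 + (2 * k - 2) = (p + (k - 1)) + k), hrec,
        (by omega : p + (k - 1) + k - 1 = p + (2 * k - 2)), ← ih p (by omega)]
      rcases lt_or_ge (p + 1) k with h | h
      · rw [add_comm p (k - 1), h1 p (by omega), A_of_lt h, A_of_lt (by omega)]
        push_cast
        ring
      · rw [A_of_le (by omega) h, (by omega : p + (k - 1) = p + 1 - k + (2 * k - 2)),
          ← ih _ (by omega)]
        push_cast
        rfl

open Filter Topology

/-! ### Oscillation -/

/-- For a non-real `u` on the unit circle, the real part of `d * u ^ p` is frequently bounded below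
by a positive constant. -/
theorem exists_frequently_lt_re_mul_pow {d u : ℂ} (hd : d ≠ 0) (hu : ‖u‖ = 1) (him : u.im ≠ 0) :
    ∃ c : ℝ, 0 < c ∧ ∃ᶠ p : ℕ in atTop, c < (d * u ^ p).re := by
  have hu1 : u - 1 ≠ 0 := by
    intro h
    rw [sub_eq_zero] at h
    simp [h] at him
  have hnorm : ∀ p : ℕ, ‖u ^ p‖ = 1 := fun p => by rw [norm_pow, hu, one_pow]
  set κ : ℝ := ‖d‖ * |u.im| / 2 with hκ
  have hκ0 : 0 < κ := by
    have := norm_pos_iff.mpr hd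
    have := abs_pos.mpr him
    positivity
  -- Two consecutive real parts cannot both be small: as u is not real, Re w and Re(wu) control Im
  -- w, and |w| = |d|.
  have hlow : ∀ p : ℕ, κ ≤ |(d * u ^ p).re| + |(d * u ^ (p + 1)).re| := by
    intro p
    set w := d * u ^ p with hw
    have e : d * u ^ (p + 1) = w * u := by rw [hw, pow_succ, mul_assoc]
    have hwn : ‖w‖ = ‖d‖ := by rw [hw, norm_mul, hnorm, mul_one]
    rw [e]
    clear_value w
    have h1 : ‖d‖ ≤ |w.re| + |w.im| := hwn ▸ Complex.norm_le_abs_re_add_abs_im w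
    have h2 : |w.im| * |u.im| ≤ |w.re| + |(w * u).re| := by
      have e2 : w.im * u.im = w.re * u.re - (w * u).re := by linarith [Complex.mul_re w u]
      rw [← abs_mul, e2]
      refine (abs_sub _ _).trans (add_le_add_left ?_ _)
      rw [abs_mul]
      exact mul_le_of_le_one_right (abs_nonneg _) (hu ▸ Complex.abs_re_le_norm u)
    have h3 : |u.im| ≤ 1 := hu ▸ Complex.abs_im_le_norm u
    have h4 : ‖d‖ * |u.im| ≤ (|w.re| + |w.im|) * |u.im| := by gcongr
    have h5 : |w.re| * |u.im| ≤ |w.re| := mul_le_of_le_one_right (abs_nonneg _) h3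
    have h6 := abs_nonneg (w * u).re
    rw [hκ]
    linarith
  -- If eventually Re ≤ κ/8, then |Re| ≤ κ/4 - Re, and `hlow` forces each sum of two consecutive
  -- real parts below -κ/2. Their partial sums would then diverge, although they are real parts of
  -- bounded geometric sums.
  refine ⟨κ / 8, by positivity, fun hev => ?_⟩
  obtain ⟨N, hN⟩ := eventually_atTop.mp hev
  simp only [not_lt] at hN
  have habs : ∀ p ≥ N, |(d * u ^ p).re| ≤ κ / 4 - (d * u ^ p).re := by
    intro p hp
    have := hN p hp
    rw [abs_le]
    constructor <;> linarith
  have hstep : ∀ j : ℕ, κ / 2 ≤ -(d * u ^ N * (1 + u) * u ^ j).re := by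
    intro j
    have h1 := hlow (N + j)
    have h2 := habs (N + j) (by omega)
    have h3 := habs (N + j + 1) (by omega)
    have e : d * u ^ N * (1 + u) * u ^ j = d * u ^ (N + j) + d * u ^ (N + j + 1) := by ring
    rw [e, Complex.add_re]
    linarith
  have hsum : ∀ L : ℕ, L * (κ / 2) ≤ 4 * ‖d‖ / ‖u - 1‖ := by
    intro L
    calc L * (κ / 2) = ∑ j ∈ Finset.range L, κ / 2 := by simp
      _ ≤ ∑ j ∈ Finset.range L, -(d * u ^ N * (1 + u) * u ^ j).re :=
        Finset.sum_le_sum fun j _ => hstep j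
      _ = -(d * u ^ N * (1 + u) * ∑ j ∈ Finset.range L, u ^ j).re := by
        rw [Finset.mul_sum, Complex.re_sum, Finset.sum_neg_distrib]
      _ ≤ ‖d * u ^ N * (1 + u) * ∑ j ∈ Finset.range L, u ^ j‖ :=
        (neg_le_abs _).trans (Complex.abs_re_le_norm _)
      _ = ‖d‖ * ‖1 + u‖ * (‖u ^ L - 1‖ / ‖u - 1‖) := by
        rw [geom_sum_eq (sub_ne_zero.mp hu1), norm_mul, norm_mul, norm_mul, norm_div, hnorm, mul_one]
      _ ≤ ‖d‖ * 2 * (2 / ‖u - 1‖) := by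
        have h1 : ‖1 + u‖ ≤ 2 := (norm_add_le _ _).trans (by rw [hu, norm_one]; norm_num)
        have h2 : ‖u ^ L - 1‖ ≤ 2 := (norm_sub_le _ _).trans (by rw [hnorm, norm_one]; norm_num)
        gcongr
      _ = 4 * ‖d‖ / ‖u - 1‖ := by ring
  obtain ⟨L, hL⟩ := exists_nat_gt (4 * ‖d‖ / ‖u - 1‖ / (κ / 2))
  rw [div_lt_iff₀ (by positivity)] at hL
  linarith [hsum L]

/-- The main term exceeds 2c infinitely often, which leaves a margin c for the error term. -/
theorem exists_frequently_mul_pow_lt {d z : ℂ} (hd : d ≠ 0) (him : z.im ≠ 0) {D : ℕ → ℝ}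
    (hD : Tendsto (fun p => D p / ‖z‖ ^ p - 2 * (d * (z / ‖z‖) ^ p).re) atTop (𝓝 0)) :
    ∃ c : ℝ, 0 < c ∧ ∃ᶠ p : ℕ in atTop, c * ‖z‖ ^ p < D p := by
  have hz : 0 < ‖z‖ := norm_pos_iff.mpr (by rintro rfl; simp at him)
  have hu : ‖z / (‖z‖ : ℂ)‖ = 1 := by
    rw [norm_div, Complex.norm_real, norm_norm, div_self hz.ne']
  have hui : (z / (‖z‖ : ℂ)).im ≠ 0 := by
    rw [Complex.div_ofReal_im]
    exact div_ne_zero him hz.ne'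
  obtain ⟨c, hc, hfr⟩ := exists_frequently_lt_re_mul_pow hd hu hui
  refine ⟨c, hc, ?_⟩
  refine (hfr.and_eventually (hD.eventually (lt_mem_nhds (neg_lt_zero.mpr hc)))).mono ?_
  rintro p ⟨h1, h2⟩
  rw [← lt_div_iff₀ (pow_pos hz p)]
  linarith

/-! ### The discrepancy along the sequence `A` -/

theorem delta_A_succ {k : ℕ} (hk : 2 ≤ k) (p : ℕ) :
    (delta k (A k (p + 1)) : ℂ) = ∑ z ∈ ((Q k).aroots ℂ).toFinset,
      z ^ p * (z ^ (2 * k - 2) * (1 - alpha k * z) * weight k z) := by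
  rw [delta, F_A_succ hk]
  push_cast
  rw [A_eq_sum hk, A_eq_sum hk, Finset.mul_sum, ← Finset.sum_sub_distrib]
  refine Finset.sum_congr rfl fun z _ => ?_
  ring

/-- The conjugate pair contributes 2 Re(d u^p) after normalisation; the β term has coefficient 0,
and all other zeros are strictly smaller in modulus. -/
theorem exists_tendsto_delta_A {k : ℕ} (hk : 6 ≤ k) : ∃ d : ℂ, d ≠ 0 ∧
    Tendsto (fun p => delta k (A k (p + 1)) / ‖r k 1‖ ^ p - 2 * (d * (r k 1 / ‖r k 1‖) ^ p).re)
      atTop (𝓝 0) := by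
  have hk2 : 2 ≤ k := by omega
  obtain ⟨hroot, hneb, -⟩ := r_one_spec hk
  have him := im_r_one_ne_zero hk
  have hρ : 0 < ‖r k 1‖ := one_pos.trans (one_lt_norm_r_one hk)
  have hαβ : (alpha k : ℂ) * beta k = 1 := by exact_mod_cast alpha_mul_beta (by omega)
  have hα0 : (alpha k : ℂ) ≠ 0 := left_ne_zero_of_mul_eq_one hαβ
  set s := ((Q k).aroots ℂ).toFinset with hs
  have hmem : ∀ {z}, z ∈ s ↔ z ^ k = z ^ (k - 1) + 1 := fun {z} => by
    rw [hs, Multiset.mem_toFinset, mem_aroots_Q]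
  set e : ℂ → ℂ := fun z => z ^ (2 * k - 2) * (1 - alpha k * z) * weight k z with he
  set z₁ := r k 1 with hz₁
  have he_conj : e ((starRingEnd ℂ) z₁) = (starRingEnd ℂ) (e z₁) := by
    simp only [he, weight_conj, map_mul, map_pow, map_sub, map_one, Complex.conj_ofReal]
  have he_beta : e (beta k) = 0 := by simp only [he, hαβ]; simp
  refine ⟨e z₁, ?_, ?_⟩
  · refine mul_ne_zero (mul_ne_zero (pow_ne_zero _ (zero_ne_of_root hk2 hroot)) ?_)
      (inv_ne_zero (derivative_ne_zero_of_root hk2 hroot))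
    -- 1 - αz = 0 would give z = 1/α = β.
    intro h
    exact hneb (mul_left_cancel₀ hα0 (by linear_combination -h - hαβ))
  · have hcne : (starRingEnd ℂ) z₁ ≠ z₁ := fun h => him (Complex.conj_eq_iff_im.mp h)
    set t := (s.erase z₁).erase ((starRingEnd ℂ) z₁) with ht
    have hsplit : ∀ p, (delta k (A k (p + 1)) : ℂ) =
        ((2 * (e z₁ * z₁ ^ p).re : ℝ) : ℂ) + ∑ z ∈ t, z ^ p * e z := by
      intro p
      rw [delta_A_succ hk2, ← Finset.add_sum_erase _ _ (hmem.mpr hroot),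
        ← Finset.add_sum_erase _ _ (Finset.mem_erase.mpr ⟨hcne, hmem.mpr (conj_root hroot)⟩),
        ← add_assoc]
      congr 1
      change z₁ ^ p * e z₁ + (starRingEnd ℂ) z₁ ^ p * e ((starRingEnd ℂ) z₁) = _
      rw [he_conj, ← map_pow, ← map_mul, mul_comm (e z₁), Complex.add_conj]
    have hlim : Tendsto (fun p : ℕ => ∑ z ∈ t, (z / ‖z₁‖) ^ p * e z) atTop (𝓝 0) := by
      rw [← Finset.sum_const_zero (s := t)]
      refine tendsto_finsetSum _ fun z hz => ?_
      rw [ht, Finset.mem_erase, Finset.mem_erase, hmem] at hz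
      by_cases hzb : z = beta k
      · simp only [hzb, he_beta, mul_zero]
        exact tendsto_const_nhds
      · rw [← zero_mul (e z)]
        refine (tendsto_pow_atTop_nhds_zero_of_norm_lt_one ?_).mul_const _
        rw [norm_div, Complex.norm_real, norm_norm, div_lt_one hρ]
        exact norm_lt_norm_r_one hk hz.2.2 hzb hz.2.1 hz.1
    have hre := (Complex.continuous_re.tendsto 0).comp hlim
    rw [Complex.zero_re] at hre
    refine hre.congr fun p => ?_
    have h1 : ∑ z ∈ t, (z / ‖z₁‖) ^ p * e z = (∑ z ∈ t, z ^ p * e z) / ((‖z₁‖ ^ p : ℝ) : ℂ) := by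
      rw [Finset.sum_div]
      refine Finset.sum_congr rfl fun z _ => ?_
      push_cast
      rw [div_pow]
      ring
    have h2 : e z₁ * (z₁ / ‖z₁‖) ^ p = (e z₁ * z₁ ^ p) / ((‖z₁‖ ^ p : ℝ) : ℂ) := by
      push_cast
      rw [div_pow]
      ring
    have h3 := congrArg Complex.re (hsplit p)
    rw [Complex.add_re, Complex.ofReal_re, Complex.ofReal_re] at h3
    rw [Function.comp_apply, h1, h2, Complex.div_ofReal_re, Complex.div_ofReal_re, h3]
    ring

theorem exponent_pos {k : ℕ} (hk : 6 ≤ k) : 0 < exponent k :=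
  div_pos (Real.log_pos (one_lt_norm_r_one hk)) (Real.log_pos (one_lt_beta (by omega)))

theorem exponent_lt_one {k : ℕ} (hk : 6 ≤ k) : exponent k < 1 := by
  obtain ⟨h1, h2, -⟩ := r_one_spec hk
  rw [exponent, div_lt_one (Real.log_pos (one_lt_beta (by omega)))]
  exact Real.log_lt_log (one_pos.trans (one_lt_norm_r_one hk)) (norm_root_lt_beta (by omega) h1 h2)

theorem beta_rpow_exponent {k : ℕ} (hk : 6 ≤ k) : beta k ^ exponent k = ‖r k 1‖ := by
  have hb := one_lt_beta (k := k) (by omega)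
  rw [Real.rpow_def_of_pos (by linarith), exponent, mul_div_cancel₀ _ (Real.log_pos hb).ne',
    Real.exp_log (one_pos.trans (one_lt_norm_r_one hk))]

/-- Raise A_{p+1} ≤ kβ · β^p to the power a and use β^a = |r_1|. -/
theorem exists_A_rpow_le {k : ℕ} (hk : 6 ≤ k) :
    ∃ K : ℝ, 0 < K ∧ ∀ p, (A k (p + 1) : ℝ) ^ exponent k ≤ K * ‖r k 1‖ ^ p := by
  have hb := (beta_spec (k := k) (by omega)).1
  have hk0 : (0 : ℝ) < k := by exact_mod_cast (by omega : 0 < k)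
  refine ⟨(k * beta k) ^ exponent k, by positivity, fun p => ?_⟩
  have h := A_le_mul_beta_pow (k := k) (by omega) (p + 1)
  calc (A k (p + 1) : ℝ) ^ exponent k ≤ (k * beta k * beta k ^ p) ^ exponent k :=
        Real.rpow_le_rpow (by positivity) (h.trans_eq (by ring)) (exponent_pos hk).le
    _ = (k * beta k) ^ exponent k * ‖r k 1‖ ^ p := by
        rw [Real.mul_rpow (by positivity) (by positivity), ← Real.rpow_pow_comm hb.le,
          beta_rpow_exponent hk]

/-- A sequence that is frequently of size `‖r k 1‖ ^ p` dominates a power of `A` along a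
subsequence. -/
theorem exists_subsequence {k : ℕ} (hk : 6 ≤ k) {g : ℕ → ℝ} {c : ℝ} (hc : 0 < c)
    (h : ∃ᶠ p : ℕ in atTop, c * ‖r k 1‖ ^ p < g (A k (p + 1))) :
    ∃ C : ℝ, 0 < C ∧ ∃ u : ℕ → ℕ, IsSubsequence u (A k) ∧
      ∀ n, C * (u n : ℝ) ^ exponent k < g (u n) := by
  obtain ⟨K, hK, hA⟩ := exists_A_rpow_le hk
  obtain ⟨φ, hφ, hφ'⟩ := extraction_of_frequently_atTop h
  refine ⟨c / K, by positivity, fun n => A k (φ n + 1),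
    ⟨fun n => φ n + 1, fun a b hab => Nat.add_lt_add_right (hφ hab) 1, fun _ => rfl⟩, fun n => ?_⟩
  refine lt_of_le_of_lt ?_ (hφ' n)
  calc c / K * (A k (φ n + 1) : ℝ) ^ exponent k ≤ c / K * (K * ‖r k 1‖ ^ φ n) := by
        gcongr
        exact hA _
    _ = c * ‖r k 1‖ ^ φ n := by field_simp

theorem tendsto_mul_rpow_of_isSubsequence {k : ℕ} (hk : 6 ≤ k) {C : ℝ} (hC : 0 < C) {u : ℕ → ℕ}
    (hu : IsSubsequence u (A k)) :
    Tendsto (fun n => C * (u n : ℝ) ^ exponent k) atTop atTop := by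
  obtain ⟨φ, hφ, hu⟩ := hu
  have h1 : Tendsto u atTop atTop := by
    rw [funext hu]
    exact (A_strictMono (by omega)).tendsto_atTop.comp hφ.tendsto_atTop
  exact ((tendsto_rpow_atTop (exponent_pos hk)).comp
    (tendsto_natCast_atTop_atTop.comp h1)).const_mul_atTop hC

theorem iSup_coe_eq_top {g : ℕ → ℝ} (h : ∀ M : ℝ, ∃ n, M < g n) :
    (⨆ n, ((g n : ℝ) : EReal)) = ⊤ := by
  refine EReal.eq_top_iff_forall_lt _ |>.mpr fun M => ?_
  obtain ⟨n, hn⟩ := h M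
  exact (EReal.coe_lt_coe_iff.mpr hn).trans_le (le_iSup (fun n => ((g n : ℝ) : EReal)) n)

theorem iInf_coe_eq_bot {g : ℕ → ℝ} (h : ∀ M : ℝ, ∃ n, g n < M) :
    (⨅ n, ((g n : ℝ) : EReal)) = ⊥ := by
  refine EReal.eq_bot_iff_forall_lt _ |>.mpr fun M => ?_
  obtain ⟨n, hn⟩ := h M
  exact (iInf_le (fun n => ((g n : ℝ) : EReal)) n).trans_lt (EReal.coe_lt_coe_iff.mpr hn)

end Hofstadter

theorem theoremt (k : ℕ) (hk : 6 ≤ k) :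
    Hofstadter.discrepancy k = ⊤ ∧
    (⨆ n : ℕ, ((Hofstadter.delta k n : ℝ) : EReal)) = ⊤ ∧
    (⨅ n : ℕ, ((Hofstadter.delta k n : ℝ) : EReal)) = ⊥ ∧
    0 < Hofstadter.exponent k ∧ Hofstadter.exponent k < 1 ∧
    ∃ C : ℝ, 0 < C ∧ ∃ u u' : ℕ → ℕ,
      Hofstadter.IsSubsequence u (Hofstadter.A k) ∧
      Hofstadter.IsSubsequence u' (Hofstadter.A k) ∧
      ∀ n : ℕ,
        Hofstadter.delta k (u n) > C * (u n : ℝ) ^ Hofstadter.exponent k ∧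
        Hofstadter.delta k (u' n) < -C * (u' n : ℝ) ^ Hofstadter.exponent k := by
  obtain ⟨d, hd, hlim⟩ := Hofstadter.exists_tendsto_delta_A hk
  have him := Hofstadter.im_r_one_ne_zero hk
  obtain ⟨c, hc, hfr⟩ := Hofstadter.exists_frequently_mul_pow_lt hd him hlim
  -- The negated discrepancy has the same asymptotic form with -d in place of d.
  obtain ⟨c', hc', hfr'⟩ := Hofstadter.exists_frequently_mul_pow_lt
    (D := fun p => -Hofstadter.delta k (Hofstadter.A k (p + 1))) (neg_ne_zero.mpr hd) him (by
      have h := hlim.neg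
      rw [neg_zero] at h
      refine h.congr fun p => ?_
      rw [neg_mul, Complex.neg_re]
      ring)
  obtain ⟨C, hC, u, hu, hCu⟩ := Hofstadter.exists_subsequence hk hc hfr
  obtain ⟨C', hC', u', hu', hCu'⟩ := Hofstadter.exists_subsequence
    (g := fun n => -Hofstadter.delta k n) hk hc' hfr'
  have hpos : ∀ M : ℝ, ∃ n, M < Hofstadter.delta k n := fun M =>
    let ⟨n, hn⟩ := ((Hofstadter.tendsto_mul_rpow_of_isSubsequence hk hC hu).eventually_gt_atTop
      M).exists
    ⟨u n, hn.trans (hCu n)⟩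
  have hneg : ∀ M : ℝ, ∃ n, Hofstadter.delta k n < M := fun M =>
    let ⟨n, hn⟩ := ((Hofstadter.tendsto_mul_rpow_of_isSubsequence hk hC' hu').eventually_gt_atTop
      (-M)).exists
    ⟨u' n, neg_lt_neg_iff.mp (hn.trans (hCu' n))⟩
  refine ⟨Hofstadter.iSup_coe_eq_top fun M => ?_, Hofstadter.iSup_coe_eq_top hpos,
    Hofstadter.iInf_coe_eq_bot hneg, Hofstadter.exponent_pos hk, Hofstadter.exponent_lt_one hk,
    min C C', lt_min hC hC', u, u', hu, hu', fun n => ⟨?_, ?_⟩⟩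
  · obtain ⟨n, hn⟩ := hpos M
    exact ⟨n, hn.trans_le (le_abs_self _)⟩
  · refine lt_of_le_of_lt ?_ (hCu n)
    gcongr
    exact min_le_left _ _
  · have h1 : min C C' * (u' n : ℝ) ^ Hofstadter.exponent k ≤
        C' * (u' n : ℝ) ^ Hofstadter.exponent k := by
      gcongr
      exact min_le_right _ _
    have h2 := hCu' n
    linarith
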